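/- All graphs and digraphs are finite, have at least one vertex, and have no loops or multiple edges or arcs; a digraph may contain both arcs $(u,v)$ and $(v,u)$. Classes of (di)graphs are closed under isomorphism. For vertex-disjoint digraphs $G_1=(V_1,E_1)$ and $G_2=(V_2,E_2)$, the disjoint union $G_1\oplus G_2$ is $(V_1\cup V_2,E_1\cup E_2)$, and the order composition $G_1\oslash G_2$ is $(V_1\cup V_2,\;E_1\cup E_2\cup\{(u,v)\mid u\in V_1,\,v\in V_2\})$. Let $\bullet$ denote a (di)graph with a single vertex and no edge or arc. The *oriented trivially perfect graphs* form the smallest class of digraphs that contains every $\bullet$ and contains $G_1\oplus G_2$, $G_1\oslash\bullet$ and $\bullet\oslash G_1$ whenever it contains $G_1$ and $G_2$. The (undirected) *trivially perfect graphs* form the smallest class of graphs that contains every $\bullet$, the disjoint union of any two of its members, and the join of any of its members with $\bullet$ (the graph obtained by adding one new vertex adjacent to all others). For a set $F$ of (di)graphs, $\mathrm{Free}(F)$ is the class of (di)graphs having no induced sub(di)graph isomorphic to a member of $F$. For a digraph $G$, $un(G)$ is the underlying undirected graph, in which $u\neq v$ are adjacent iff $(u,v)$ or $(v,u)$ is an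 arc of $G$. A digraph is *transitive* if for all arcs $(u,v)$, $(v,w)$ with $u\ne w$, also $(u,w)$ is an arc. Let $P_4$ and $C_4$ be the undirected path and cycle on four vertices, and let - $D_1$ be the directed path $a\to b\to c$, - $D_5$ be the directed cycle $a\to b\to c\to a$, - $D_8$ be the orientation $a\to b\leftarrow c\to d$ of $P_4$, - $D_{12}$ be the orientation of $C_4$ with vertices $a,b,c,d$ and arcs $(a,c),(a,d),(b,c),(b,d)$, - $\overleftrightarrow{K_2}$ be the digraph with two vertices $a,b$ and arcs $(a,b),(b,a)$. **Theorem.** Let $G$ be a digraph. The following properties are equivalent: 1. $G$ is an oriented trivially perfect graph. 2. $G\in\mathrm{Free}(\{D_1,D_5,D_8,D_{12},\overleftrightarrow{K_2}\})$. 3. $G\in\mathrm{Free}(\{D_1,D_5,\overleftrightarrow{K_2}\})$ and $un(G)\in\mathrm{Free}(\{C_4,P_4\})$. 4. $G\in\mathrm{Free}(\{D_1,D_5,\overleftrightarrow{K_2}\})$ and $un(G)$ is a trivially perfect graph. 5. $G$ is transitive and $G\in\mathrm{Free}(\{\overleftrightarrow{K_2},D_8,D_{12}\})$. -/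

import Mathlib

/-! Digraphs are Mathlib's `Digraph`s (one arc relation, so no multiple arcs); that the given digraph
has no loops is a hypothesis of the theorem. All digraphs built below are loopless. -/

namespace Digraph

universe u v

/-- Every arc joins two distinct vertices. -/
def Loopless {V : Type u} (G : Digraph V) : Prop := ∀ x, ¬ G.Adj x x

/-- The disjoint union `G₁ ⊕ G₂`. -/
def disjUnion {V : Type u} {W : Type v} (G₁ : Digraph V) (G₂ : Digraph W) : Digraph (V ⊕ W) where
  Adj
    | Sum.inl x, Sum.inl y => G₁.Adj x y
    | Sum.inr x, Sum.inr y => G₂.Adj x y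
    | Sum.inl _, Sum.inr _ => False
    | Sum.inr _, Sum.inl _ => False

/-- The order composition `G₁ ⊘ G₂`: the disjoint union together with all arcs from the vertices
of `G₁` to the vertices of `G₂`. -/
def orderComp {V : Type u} {W : Type v} (G₁ : Digraph V) (G₂ : Digraph W) : Digraph (V ⊕ W) where
  Adj
    | Sum.inl x, Sum.inl y => G₁.Adj x y
    | Sum.inr x, Sum.inr y => G₂.Adj x y
    | Sum.inl _, Sum.inr _ => True
    | Sum.inr _, Sum.inl _ => False

/-- The digraph `•` with a single vertex and no arc. -/
def single : Digraph PUnit.{u + 1} := ⊥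

/-- Oriented trivially perfect graphs: the digraphs obtained from `•` by disjoint unions and by order
compositions with `•` on either side. The constructor `iso` says that vertices may be renamed. -/
inductive IsOrientedTriviallyPerfect : ∀ {V : Type u}, Digraph V → Prop
  | single : IsOrientedTriviallyPerfect Digraph.single
  | disjUnion {V W : Type u} {G₁ : Digraph V} {G₂ : Digraph W} :
      IsOrientedTriviallyPerfect G₁ → IsOrientedTriviallyPerfect G₂ →
      IsOrientedTriviallyPerfect (G₁.disjUnion G₂)
  | orderComp_single {V : Type u} {G : Digraph V} :
      IsOrientedTriviallyPerfect G → IsOrientedTriviallyPerfect (G.orderComp Digraph.single)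
  | single_orderComp {V : Type u} {G : Digraph V} :
      IsOrientedTriviallyPerfect G → IsOrientedTriviallyPerfect (Digraph.single.orderComp G)
  | iso {V W : Type u} {G : Digraph V} {H : Digraph W} :
      G.Adj ≃r H.Adj → IsOrientedTriviallyPerfect G → IsOrientedTriviallyPerfect H

/-- `H` is isomorphic to an induced subdigraph of `G`: some injection of the vertices preserves and
reflects arcs. -/
def IsIndContained {V : Type u} {W : Type v} (H : Digraph V) (G : Digraph W) : Prop :=
  Nonempty (H.Adj ↪r G.Adj)

/-- `G ∈ Free(F)`: no induced subdigraph of `G` is isomorphic to a member of `F`. -/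
def Free (F : Set (Σ n : ℕ, Digraph (Fin n))) {V : Type u} (G : Digraph V) : Prop :=
  ∀ H ∈ F, ¬ H.2.IsIndContained G

/-- A digraph is transitive if for all arcs `(x, y)` and `(y, z)` with `x ≠ z` also `(x, z)` is an
arc. -/
def IsTransitive {V : Type u} (G : Digraph V) : Prop :=
  ∀ x y z, G.Adj x y → G.Adj y z → x ≠ z → G.Adj x z

/-- The digraph with vertices `0, …, n - 1` and the listed arcs. -/
def ofArcs (n : ℕ) (A : Finset (Fin n × Fin n)) : Σ n : ℕ, Digraph (Fin n) :=
  ⟨n, ⟨fun i j => (i, j) ∈ A⟩⟩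

/-- The directed path on three vertices. -/
def D1 : Σ n : ℕ, Digraph (Fin n) := ofArcs 3 {(0, 1), (1, 2)}

/-- The directed cycle on three vertices. -/
def D5 : Σ n : ℕ, Digraph (Fin n) := ofArcs 3 {(0, 1), (1, 2), (2, 0)}

/-- The transitive (alternating) orientation of the path on four vertices. -/
def D8 : Σ n : ℕ, Digraph (Fin n) := ofArcs 4 {(0, 1), (2, 1), (2, 3)}

/-- The transitive orientation of the cycle `0, 2, 1, 3`: all arcs from `{0, 1}` to `{2, 3}`. -/
def D12 : Σ n : ℕ, Digraph (Fin n) := ofArcs 4 {(0, 2), (0, 3), (1, 2), (1, 3)}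

/-- The complete biorientation of `K₂`: two vertices joined by arcs in both directions. -/
def biK2 : Σ n : ℕ, Digraph (Fin n) := ofArcs 2 {(0, 1), (1, 0)}

end Digraph

namespace SimpleGraph

universe u

/-- Trivially perfect graphs: the graphs obtained from the one-vertex graph by disjoint unions and by
joins with the one-vertex graph (i.e. adding a dominating vertex), up to isomorphism. -/
inductive IsTriviallyPerfect : ∀ {V : Type u}, SimpleGraph V → Prop
  | single : IsTriviallyPerfect (⊥ : SimpleGraph PUnit.{u + 1})
  | disjUnion {V W : Type u} {G₁ : SimpleGraph V} {G₂ : SimpleGraph W} :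
      IsTriviallyPerfect G₁ → IsTriviallyPerfect G₂ → IsTriviallyPerfect (G₁.sum G₂)
  | join_single {V : Type u} {G : SimpleGraph V} :
      IsTriviallyPerfect G →
      IsTriviallyPerfect
        (G.sum (⊥ : SimpleGraph PUnit.{u + 1}) ⊔ completeBipartiteGraph V PUnit.{u + 1})
  | iso {V W : Type u} {G : SimpleGraph V} {H : SimpleGraph W} :
      G ≃g H → IsTriviallyPerfect G → IsTriviallyPerfect H

/-- `G ∈ Free(F)`: no induced subgraph of `G` is isomorphic to a member of `F`. -/
def IndFree (F : Set (Σ n : ℕ, SimpleGraph (Fin n))) {V : Type u} (G : SimpleGraph V) : Prop :=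
  ∀ H ∈ F, ¬ H.2.IsIndContained G

end SimpleGraph

/-! All five conditions are compared with `Digraph.IsNestedOrder`: the arcs form a strict partial
order, and every path on four vertices in the comparability graph has a chord joining two vertices
at distance two along it. Closure under the operations is a case check. Conversely, in a finite
graph with nested neighbourhoods a vertex of maximum degree dominates its component, so the graph
splits or has a dominating vertex. In the ordered case a dominating vertex only makes some vertex
comparable to all others; `exists_source_or_sink` upgrades this to a least or greatest element,
which can be peeled off. For the forbidden subdigraphs, `D1` and `D5` are the failures of
transitivity, and `D8` and `D12` are the transitive orientations of the chordless configurations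
`P₄` and `C₄`. -/

namespace SimpleGraph

universe u

variable {V : Type u} {G : SimpleGraph V}

/-! ### Undirected graphs: nested neighbourhoods and trivial perfection. -/

/-- The closed neighbourhoods of any two adjacent vertices are comparable by inclusion. -/
def NestedNeighborhoods (G : SimpleGraph V) : Prop :=
  ∀ a b c d, G.Adj a b → G.Adj b c → G.Adj c d → a ≠ c → b ≠ d → G.Adj a c ∨ G.Adj b d

theorem NestedNeighborhoods.of_embedding {W : Type*} {H : SimpleGraph W}
    (h : H.NestedNeighborhoods) (f : G ↪g H) : G.NestedNeighborhoods := by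
  intro a b c d hab hbc hcd hac hbd
  simpa using h (f a) (f b) (f c) (f d) (by simpa) (by simpa) (by simpa) (by simpa) (by simpa)

/-- Four distinct vertices with the same adjacencies as `H` form an induced copy of `H`. -/
theorem isIndContained_of_four {H : SimpleGraph (Fin 4)} {a b c d : V} (hab : a ≠ b) (hac : a ≠ c)
    (had : a ≠ d) (hbc : b ≠ c) (hbd : b ≠ d) (hcd : c ≠ d) (h01 : G.Adj a b ↔ H.Adj 0 1)
    (h02 : G.Adj a c ↔ H.Adj 0 2) (h03 : G.Adj a d ↔ H.Adj 0 3) (h12 : G.Adj b c ↔ H.Adj 1 2)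
    (h13 : G.Adj b d ↔ H.Adj 1 3) (h23 : G.Adj c d ↔ H.Adj 2 3) : H.IsIndContained G := by
  refine ⟨⟨⟨![a, b, c, d], ?_⟩, ?_⟩⟩
  · intro i j
    fin_cases i <;> fin_cases j <;> simp [*, Ne.symm, hab.symm, hac.symm, had.symm, hbc.symm,
      hbd.symm, hcd.symm]
  · intro i j
    change G.Adj (![a, b, c, d] i) (![a, b, c, d] j) ↔ H.Adj i j
    fin_cases i <;> fin_cases j <;> simp [h01, h02, h03, h12, h13, h23, G.adj_comm b a,
      G.adj_comm c a, G.adj_comm d a, G.adj_comm c b, G.adj_comm d b, G.adj_comm d c,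
      H.adj_comm 1 0, H.adj_comm 2 0, H.adj_comm 3 0, H.adj_comm 2 1, H.adj_comm 3 1,
      H.adj_comm 3 2]

/-- A violation is a path `a b c d` lacking the chords `ac` and `bd`; the remaining pair `ad`
decides between `C₄` and `P₄`. -/
theorem nestedNeighborhoods_iff_indFree :
    G.NestedNeighborhoods ↔ G.IndFree {⟨4, cycleGraph 4⟩, ⟨4, pathGraph 4⟩} := by
  have c4 : ∀ i j, (cycleGraph 4).Adj i j ↔ i - j = 1 ∨ j - i = 1 := fun i j ↦ cycleGraph_adj
  constructor
  · rintro h H (rfl | rfl) ⟨f⟩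
    · have := h.of_embedding f 0 1 2 3
      simp only [c4] at this
      exact absurd this (by decide)
    · have := h.of_embedding f 0 1 2 3
      simp only [pathGraph_adj] at this
      exact absurd this (by decide)
  · intro h a b c d hab hbc hcd hac hbd
    by_contra! hn
    have had : a ≠ d := by
      rintro rfl
      exact hn.1 hcd.symm
    by_cases e : G.Adj a d
    · refine h _ (Or.inl rfl) (isIndContained_of_four hab.ne hac had hbc.ne hbd hcd.ne ?_ ?_ ?_ ?_ ?_ ?_)
        <;> simp only [c4, hab, hbc, hcd, hn, e] <;> decide
    · refine h _ (Or.inr rfl) (isIndContained_of_four hab.ne hac had hbc.ne hbd hcd.ne ?_ ?_ ?_ ?_ ?_ ?_)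
        <;> simp only [pathGraph_adj, hab, hbc, hcd, hn, e] <;> decide

theorem IsTriviallyPerfect.nestedNeighborhoods (h : G.IsTriviallyPerfect) :
    G.NestedNeighborhoods := by
  induction h with
  | single => intro a b c d hab; simp at hab
  | disjUnion _ _ h₁ h₂ =>
    rintro (a | a) (b | b) (c | c) (d | d)
    all_goals simp
    · exact h₁ a b c d
    · exact h₂ a b c d
  | join_single _ h =>
    rintro (a | a) (b | b) (c | c) (d | d)
    all_goals simp
    exact h a b c d
  | iso e _ h => exact h.of_embedding e.symm.toEmbedding

/-- A vertex of maximum degree is adjacent to its whole connected component. -/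
theorem NestedNeighborhoods.exists_adj_of_adj_adj [Finite V] [Nonempty V]
    (h : G.NestedNeighborhoods) :
    ∃ v, ∀ x y, G.Adj v x → G.Adj x y → y ≠ v → G.Adj v y := by
  obtain ⟨v, hv⟩ := Finite.exists_max fun v ↦ (insert v (G.neighborSet v)).ncard
  refine ⟨v, fun x y hvx hxy hyv ↦ ?_⟩
  by_contra hvy
  -- Nestedness puts the closed neighbourhood of `v` inside that of `x`, and `y` makes the inclusion
  -- strict, against maximality.
  refine (hv x).not_gt (Set.ncard_lt_ncard ?_ (Set.toFinite _))
  refine (Set.ssubset_iff_of_subset ?_).2 ⟨y, ?_, ?_⟩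
  · rintro z (rfl | hz)
    · exact Or.inr hvx.symm
    · by_cases hzx : z = x
      · exact Or.inl hzx
      · refine Or.inr ?_
        have := h z v x y hz.symm hvx hxy hzx hyv.symm
        exact (this.resolve_right hvy).symm
  · exact Or.inr hxy
  · rintro (h | h)
    exacts [hyv h, hvy h]

/-- A finite graph with nested neighbourhoods is disconnected or has a dominating vertex. -/
theorem NestedNeighborhoods.split_or_dominating [Finite V] [Nonempty V]
    (h : G.NestedNeighborhoods) :
    (∃ p : V → Prop, (∃ x, p x) ∧ (∃ x, ¬ p x) ∧ ∀ x y, p x → ¬ p y → ¬ G.Adj x y) ∨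
      ∃ v, ∀ x, x ≠ v → G.Adj v x := by
  obtain ⟨v, hv⟩ := h.exists_adj_of_adj_adj
  by_cases hd : ∀ x, x ≠ v → G.Adj v x
  · exact Or.inr ⟨v, hd⟩
  · push Not at hd
    obtain ⟨w, hwv, hw⟩ := hd
    -- By `hv` the closed neighbourhood of `v` is a whole component, and `w` lies outside it.
    refine Or.inl ⟨fun x ↦ x = v ∨ G.Adj v x, ⟨v, Or.inl rfl⟩, ⟨w, by tauto⟩, ?_⟩
    rintro x y (rfl | hx) hy hxy
    · exact hy (Or.inr hxy)
    · exact hy (or_iff_not_imp_left.2 (hv x y hx hxy))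

end SimpleGraph

/-- Splitting off one element of a type. -/
noncomputable def Equiv.sumNePUnit {V : Type*} (v : V) : {x // x ≠ v} ⊕ PUnit ≃ V :=
  Equiv.ofBijective (Sum.elim Subtype.val fun _ ↦ v) <| by
    constructor
    · rintro (⟨x, hx⟩ | x) (⟨y, hy⟩ | y) <;> simp_all [Ne.symm]
    · intro x
      by_cases hx : x = v
      · exact ⟨Sum.inr PUnit.unit, hx.symm⟩
      · exact ⟨Sum.inl ⟨x, hx⟩, rfl⟩

@[simp]
theorem Equiv.sumNePUnit_inl {V : Type*} (v : V) (x : {x // x ≠ v}) :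
    Equiv.sumNePUnit v (Sum.inl x) = x := rfl

@[simp]
theorem Equiv.sumNePUnit_inr {V : Type*} (v : V) (x : PUnit) :
    Equiv.sumNePUnit v (Sum.inr x) = v := rfl

namespace SimpleGraph

universe u

theorem NestedNeighborhoods.isTriviallyPerfect {V : Type u} [Finite V] [Nonempty V]
    {G : SimpleGraph V} (h : G.NestedNeighborhoods) : G.IsTriviallyPerfect := by
  induction hn : Nat.card V using Nat.strong_induction_on generalizing V with
  | _ n ih =>
  subst hn
  have key (p : V → Prop) (hp : ∃ x, p x) (hq : ∃ x, ¬ p x) :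
      (G.comap (Subtype.val : {x // p x} → V)).IsTriviallyPerfect := by
    obtain ⟨x, hx⟩ := hp
    have : Nonempty {x // p x} := ⟨x, hx⟩
    exact ih _ (Finite.card_subtype_lt hq.choose_spec)
      (h.of_embedding (Embedding.comap (Function.Embedding.subtype p) G)) rfl
  obtain ⟨p, hp, hq, hpq⟩ | ⟨v, hv⟩ := h.split_or_dominating
  · classical
    refine .iso ⟨Equiv.sumCompl p, ?_⟩ (.disjUnion (key p hp hq)
      (key (fun x ↦ ¬ p x) hq (by simpa using hp)))
    rintro (⟨x, hx⟩ | ⟨x, hx⟩) (⟨y, hy⟩ | ⟨y, hy⟩) <;> simp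
    · exact hpq x y hx hy
    · exact fun e ↦ hpq y x hy hx e.symm
  · by_cases hs : ∃ x, x ≠ v
    · refine .iso ⟨Equiv.sumNePUnit v, ?_⟩ (.join_single (key (· ≠ v) hs ⟨v, by simp⟩))
      rintro (⟨x, hx⟩ | x) (⟨y, hy⟩ | y) <;> simp
      · exact (hv x hx).symm
      · exact hv y hy
    · push Not at hs
      refine .iso ⟨⟨fun _ ↦ v, fun _ ↦ PUnit.unit, fun _ ↦ rfl, fun x ↦ (hs x).symm⟩, ?_⟩ .single
      simp

theorem nestedNeighborhoods_iff_isTriviallyPerfect {V : Type u} [Finite V] [Nonempty V]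
    {G : SimpleGraph V} : G.NestedNeighborhoods ↔ G.IsTriviallyPerfect :=
  ⟨fun h ↦ h.isTriviallyPerfect, fun h ↦ h.nestedNeighborhoods⟩

end SimpleGraph

/-! ### Digraphs: building nested orders from single vertices. -/

namespace Digraph

universe u

variable {V : Type u} {G : Digraph V}

/-- No two vertices are joined by arcs in both directions (so there are no loops either). -/
def IsAsymmetric (G : Digraph V) : Prop := ∀ x y, G.Adj x y → ¬ G.Adj y x

theorem toSimpleGraphInclusive_adj {x y : V} :
    G.toSimpleGraphInclusive.Adj x y ↔ x ≠ y ∧ (G.Adj x y ∨ G.Adj y x) := Iff.rfl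

theorem IsAsymmetric.inclusive_adj (h : G.IsAsymmetric) {x y : V} :
    G.toSimpleGraphInclusive.Adj x y ↔ G.Adj x y ∨ G.Adj y x := by
  rw [toSimpleGraphInclusive_adj, and_iff_right_iff_imp]
  rintro (e | e) rfl <;> exact h _ _ e e

/-- The property of being transitive, antisymmetric and with nested neighbourhoods in the underlying
graph, to which all the characterizations are compared. -/
structure IsNestedOrder (G : Digraph V) : Prop where
  asymm : G.IsAsymmetric
  trans : ∀ x y z, G.Adj x y → G.Adj y z → G.Adj x z
  nested : ∀ a b c d, G.Adj a b ∨ G.Adj b a → G.Adj b c ∨ G.Adj c b → G.Adj c d ∨ G.Adj d c →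
    a ≠ c → b ≠ d → (G.Adj a c ∨ G.Adj c a) ∨ (G.Adj b d ∨ G.Adj d b)

/-- Asymmetry excludes `x = z` for arcs `x → y → z`, so the proviso `x ≠ z` in `IsTransitive` costs
nothing. -/
theorem isNestedOrder_iff : G.IsNestedOrder ↔
    G.IsAsymmetric ∧ G.IsTransitive ∧ G.toSimpleGraphInclusive.NestedNeighborhoods := by
  constructor
  · intro h
    refine ⟨h.asymm, fun x y z hxy hyz _ ↦ h.trans x y z hxy hyz, ?_⟩
    intro a b c d
    simp only [h.asymm.inclusive_adj]
    exact h.nested a b c d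
  · rintro ⟨h₁, h₂, h₃⟩
    refine ⟨h₁, fun x y z hxy hyz ↦ h₂ x y z hxy hyz ?_, fun a b c d ↦ ?_⟩
    · rintro rfl
      exact h₁ _ _ hxy hyz
    · simpa only [h₁.inclusive_adj] using h₃ a b c d

theorem IsNestedOrder.of_embedding {W : Type*} {H : Digraph W} (h : H.IsNestedOrder)
    (f : G.Adj ↪r H.Adj) : G.IsNestedOrder where
  asymm x y := by simpa only [f.map_rel_iff] using h.asymm (f x) (f y)
  trans x y z := by simpa only [f.map_rel_iff] using h.trans (f x) (f y) (f z)
  nested a b c d := by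
    simpa only [f.map_rel_iff, ne_eq, f.injective.eq_iff] using h.nested (f a) (f b) (f c) (f d)

theorem IsOrientedTriviallyPerfect.isNestedOrder (h : G.IsOrientedTriviallyPerfect) :
    G.IsNestedOrder := by
  induction h with
  | single => exact ⟨fun _ _ h ↦ h.elim, fun _ _ _ h ↦ h.elim, fun _ _ _ _ h ↦ by simp [Digraph.single] at h⟩
  | disjUnion _ _ h₁ h₂ =>
    refine ⟨?_, ?_, ?_⟩
    · rintro (a | a) (b | b) <;> simp [Digraph.disjUnion]
      exacts [h₁.asymm a b, h₂.asymm a b]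
    · rintro (a | a) (b | b) (c | c) <;> simp [Digraph.disjUnion]
      exacts [h₁.trans a b c, h₂.trans a b c]
    · rintro (a | a) (b | b) (c | c) (d | d) <;> simp [Digraph.disjUnion]
      exacts [h₁.nested a b c d, h₂.nested a b c d]
  | orderComp_single _ h =>
    refine ⟨?_, ?_, ?_⟩
    · rintro (a | a) (b | b) <;> simp [Digraph.orderComp, Digraph.single]
      exact h.asymm a b
    · rintro (a | a) (b | b) (c | c) <;> simp [Digraph.orderComp, Digraph.single]
      exact h.trans a b c
    · rintro (a | a) (b | b) (c | c) (d | d) <;> simp [Digraph.orderComp, Digraph.single]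
      exact h.nested a b c d
  | single_orderComp _ h =>
    refine ⟨?_, ?_, ?_⟩
    · rintro (a | a) (b | b) <;> simp [Digraph.orderComp, Digraph.single]
      exact h.asymm a b
    · rintro (a | a) (b | b) (c | c) <;> simp [Digraph.orderComp, Digraph.single]
      exact h.trans a b c
    · rintro (a | a) (b | b) (c | c) (d | d) <;> simp [Digraph.orderComp, Digraph.single]
      exact h.nested a b c d
  | iso e _ h => exact h.of_embedding e.symm.toRelEmbedding

/-- If some vertex is comparable to all others, then there is a least or a greatest vertex. -/
theorem IsNestedOrder.exists_source_or_sink [Finite V] (h : G.IsNestedOrder) {v : V}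
    (hv : ∀ x, x ≠ v → G.Adj v x ∨ G.Adj x v) :
    (∃ s, ∀ x, x ≠ s → G.Adj s x) ∨ ∃ t, ∀ x, x ≠ t → G.Adj x t := by
  have irr (x : V) : ¬ G.Adj x x := fun e ↦ h.asymm x x e e
  have : IsTrans V G.Adj := ⟨h.trans⟩
  have : Std.Irrefl G.Adj := ⟨irr⟩
  have : IsTrans V (Function.swap G.Adj) := ⟨fun x y z hxy hyz ↦ h.trans z y x hyz hxy⟩
  have : Std.Irrefl (Function.swap G.Adj) := ⟨irr⟩
  -- `K` is a chain; let `s` be its minimum and `t` its maximum. If neither is extreme in `V`, there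
  -- are `a` below `s` and `b` above `t`, both outside `K`. A vertex `a'` incomparable to `a` is
  -- also below `s`, and a vertex `b'` incomparable to `b` is also above `t`. Then `a, b, a', b'` is
  -- a path violating nestedness.
  let K : Set V := {w | ∀ x, x ≠ w → G.Adj w x ∨ G.Adj x w}
  obtain ⟨s, hs, hs'⟩ := (Finite.wellFounded_of_trans_of_irrefl G.Adj).has_min K ⟨v, hv⟩
  obtain ⟨t, ht, ht'⟩ :=
    (Finite.wellFounded_of_trans_of_irrefl (Function.swap G.Adj)).has_min K ⟨v, hv⟩
  by_contra! hn
  obtain ⟨hn₁, hn₂⟩ := hn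
  obtain ⟨a, has, has'⟩ := hn₁ s
  obtain ⟨b, hbt, hbt'⟩ := hn₂ t
  replace has' : G.Adj a s := (hs a has).resolve_left has'
  replace hbt' : G.Adj t b := (ht b hbt).resolve_right hbt'
  have ha : a ∉ K := fun ha ↦ hs' a ha has'
  have hb : b ∉ K := fun hb ↦ ht' b hb hbt'
  simp only [K, Set.mem_ofPred_eq, not_forall] at ha hb
  obtain ⟨a', haa', ha'⟩ := ha
  obtain ⟨b', hbb', hb'⟩ := hb
  have ha's : G.Adj a' s := by
    have : a' ≠ s := by
      rintro rfl
      exact ha' (Or.inl has')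
    exact (hs a' this).resolve_left fun e ↦ ha' (Or.inl (h.trans _ _ _ has' e))
  have htb' : G.Adj t b' := by
    have : b' ≠ t := by
      rintro rfl
      exact hb' (Or.inr hbt')
    exact (ht b' this).resolve_right fun e ↦ hb' (Or.inr (h.trans _ _ _ e hbt'))
  have st : s = t ∨ G.Adj s t := by
    by_cases e : s = t
    · exact Or.inl e
    · exact Or.inr ((ht s e).resolve_left (hs' t ht))
  have hst (x y : V) (hx : G.Adj x s) (hy : G.Adj t y) : G.Adj x y := by
    obtain rfl | e := st
    · exact h.trans _ _ _ hx hy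
    · exact h.trans _ _ _ hx (h.trans _ _ _ e hy)
  have := h.nested a b a' b' (Or.inl (hst _ _ has' hbt')) (Or.inr (hst _ _ ha's hbt'))
    (Or.inl (hst _ _ ha's htb')) haa'.symm hbb'.symm
  tauto

theorem IsNestedOrder.isOrientedTriviallyPerfect [Finite V] [Nonempty V] (h : G.IsNestedOrder) :
    G.IsOrientedTriviallyPerfect := by
  induction hn : Nat.card V using Nat.strong_induction_on generalizing V with
  | _ n ih =>
  subst hn
  have irr (x : V) : ¬ G.Adj x x := fun e ↦ h.asymm x x e e
  have key (p : V → Prop) (hp : ∃ x, p x) (hq : ∃ x, ¬ p x) :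
      (⟨fun x y ↦ G.Adj x y⟩ : Digraph {x // p x}).IsOrientedTriviallyPerfect := by
    obtain ⟨x, hx⟩ := hp
    have : Nonempty {x // p x} := ⟨x, hx⟩
    exact ih _ (Finite.card_subtype_lt hq.choose_spec)
      (h.of_embedding ⟨Function.Embedding.subtype p, Iff.rfl⟩) rfl
  by_cases hs : ∃ x y : V, x ≠ y
  swap
  · push Not at hs
    let v : V := Classical.arbitrary V
    refine .iso ⟨⟨fun _ ↦ v, fun _ ↦ PUnit.unit, fun _ ↦ rfl, fun x ↦ hs _ _⟩, ?_⟩ .single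
    simp [irr, Digraph.single]
  have ne (v : V) : ∃ x, x ≠ v := by
    obtain ⟨x, y, hxy⟩ := hs
    by_cases e : x = v
    · exact ⟨y, fun e' ↦ hxy (e.trans e'.symm)⟩
    · exact ⟨x, e⟩
  obtain ⟨p, hp, hq, hpq⟩ | ⟨v, hv⟩ := (isNestedOrder_iff.1 h).2.2.split_or_dominating
  · classical
    simp only [h.asymm.inclusive_adj, not_or] at hpq
    refine .iso ⟨Equiv.sumCompl p, ?_⟩ (.disjUnion (key p hp hq)
      (key (fun x ↦ ¬ p x) hq (by simpa using hp)))
    rintro (⟨x, hx⟩ | ⟨x, hx⟩) (⟨y, hy⟩ | ⟨y, hy⟩) <;> simp [Digraph.disjUnion]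
    · exact (hpq x y hx hy).1
    · exact (hpq y x hy hx).2
  · simp only [h.asymm.inclusive_adj] at hv
    obtain ⟨s, hs⟩ | ⟨t, ht⟩ := h.exists_source_or_sink hv
    · refine .iso ⟨(Equiv.sumComm _ _).trans (Equiv.sumNePUnit s), ?_⟩
        (.single_orderComp (key (· ≠ s) (ne s) ⟨s, by simp⟩))
      rintro (x | ⟨x, hx⟩) (y | ⟨y, hy⟩) <;> simp [Digraph.orderComp, Digraph.single, irr]
      · exact hs y hy
      · exact h.asymm _ _ (hs x hx)
    · refine .iso ⟨Equiv.sumNePUnit t, ?_⟩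
        (.orderComp_single (key (· ≠ t) (ne t) ⟨t, by simp⟩))
      rintro (⟨x, hx⟩ | x) (⟨y, hy⟩ | y) <;> simp [Digraph.orderComp, Digraph.single, irr]
      · exact ht x hx
      · exact h.asymm _ _ (ht y hy)

/-! ### Forbidden induced subdigraphs. -/

theorem ofArcs_isIndContained_iff {n : ℕ} {A : Finset (Fin n × Fin n)} :
    (ofArcs n A).2.IsIndContained G ↔
      ∃ f : Fin n → V, Function.Injective f ∧ ∀ i j, G.Adj (f i) (f j) ↔ (i, j) ∈ A :=
  ⟨fun ⟨f⟩ ↦ ⟨f, f.injective, fun _ _ ↦ f.map_rel_iff⟩,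
    fun ⟨f, hf, h⟩ ↦ ⟨⟨⟨f, hf⟩, fun {i j} ↦ h i j⟩⟩⟩

theorem Loopless.not_isIndContained_biK2_iff (hG : G.Loopless) :
    ¬ biK2.2.IsIndContained G ↔ G.IsAsymmetric := by
  constructor
  · intro h x y hxy hyx
    have hne : x ≠ y := by
      rintro rfl
      exact hG _ hxy
    refine h (ofArcs_isIndContained_iff.2 ⟨![x, y], ?_, ?_⟩)
    · intro i j
      fin_cases i <;> fin_cases j <;> simp [hne, hne.symm]
    · intro i j
      fin_cases i <;> fin_cases j <;> simp [hxy, hyx, hG x, hG y]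
  · intro h e
    obtain ⟨f, -, hf⟩ := ofArcs_isIndContained_iff.1 e
    exact h (f 0) (f 1) ((hf _ _).2 (by decide)) ((hf _ _).2 (by decide))

/-- When `x → y → z` lacks the arc `x → z`, asymmetry leaves only `z → x` undecided: present it
gives `D5`, absent `D1`. -/
theorem IsAsymmetric.isTransitive_iff (h : G.IsAsymmetric) :
    G.IsTransitive ↔ ¬ D1.2.IsIndContained G ∧ ¬ D5.2.IsIndContained G := by
  have irr (x : V) : ¬ G.Adj x x := fun e ↦ h x x e e
  constructor
  · refine fun t ↦ ⟨?_, ?_⟩ <;> intro e <;>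
    · obtain ⟨f, inj, hf⟩ := ofArcs_isIndContained_iff.1 e
      have := t (f 0) (f 1) (f 2) ((hf _ _).2 (by decide)) ((hf _ _).2 (by decide))
        (inj.ne (by decide))
      exact absurd ((hf _ _).1 this) (by decide)
  · rintro ⟨h₁, h₅⟩ x y z hxy hyz hxz
    by_contra hn
    have exy : x ≠ y := by
      rintro rfl
      exact irr _ hxy
    have eyz : y ≠ z := by
      rintro rfl
      exact irr _ hyz
    have inj : Function.Injective (![x, y, z] : Fin 3 → V) := by
      intro i j
      fin_cases i <;> fin_cases j <;> simp [exy, eyz, hxz, exy.symm, eyz.symm, hxz.symm]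
    by_cases hzx : G.Adj z x
    · refine h₅ (ofArcs_isIndContained_iff.2 ⟨_, inj, ?_⟩)
      intro i j
      fin_cases i <;> fin_cases j <;>
        simp [hxy, hyz, hzx, hn, irr, h _ _ hxy, h _ _ hyz]
    · refine h₁ (ofArcs_isIndContained_iff.2 ⟨_, inj, ?_⟩)
      intro i j
      fin_cases i <;> fin_cases j <;>
        simp [hxy, hyz, hzx, hn, irr, h _ _ hxy, h _ _ hyz]

/-- Two consecutive arcs in the same direction would yield a chord by transitivity, so orientations
alternate along a violating path. -/
theorem exists_alternating_of_not_nestedNeighborhoods (h : G.IsAsymmetric) (t : G.IsTransitive)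
    (hn : ¬ G.toSimpleGraphInclusive.NestedNeighborhoods) :
    ∃ a b c d, G.Adj a b ∧ G.Adj c b ∧ G.Adj c d ∧ a ≠ c ∧ b ≠ d ∧
      ¬ (G.Adj a c ∨ G.Adj c a) ∧ ¬ (G.Adj b d ∨ G.Adj d b) := by
  simp only [SimpleGraph.NestedNeighborhoods, h.inclusive_adj, not_forall] at hn
  obtain ⟨a, b, c, d, hab, hbc, hcd, hac, hbd, hn⟩ := hn
  rw [not_or] at hn
  obtain hab | hba := hab
  · have hcb : G.Adj c b := hbc.resolve_left fun e ↦ hn.1 (Or.inl (t _ _ _ hab e hac))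
    have hcd : G.Adj c d := hcd.resolve_right fun e ↦ hn.2 (Or.inr (t _ _ _ e hcb hbd.symm))
    exact ⟨a, b, c, d, hab, hcb, hcd, hac, hbd, hn.1, hn.2⟩
  · have hbc : G.Adj b c := hbc.resolve_right fun e ↦ hn.1 (Or.inr (t _ _ _ e hba hac.symm))
    have hdc : G.Adj d c := hcd.resolve_left fun e ↦ hn.2 (Or.inl (t _ _ _ hbc e hbd))
    -- The opposite alternation becomes the required one when the path is read backwards.
    exact ⟨d, c, b, a, hdc, hbc, hba, hbd.symm, hac.symm, by tauto, by tauto⟩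

theorem IsAsymmetric.nestedNeighborhoods_iff (h : G.IsAsymmetric) (t : G.IsTransitive) :
    G.toSimpleGraphInclusive.NestedNeighborhoods ↔
      ¬ D8.2.IsIndContained G ∧ ¬ D12.2.IsIndContained G := by
  have irr (x : V) : ¬ G.Adj x x := fun e ↦ h x x e e
  constructor
  · intro hq
    have hG : G.IsNestedOrder := isNestedOrder_iff.2 ⟨h, t, hq⟩
    constructor <;> intro e <;>
      obtain ⟨f, inj, hf⟩ := ofArcs_isIndContained_iff.1 e
    · rcases hG.nested (f 0) (f 1) (f 2) (f 3) (Or.inl ((hf _ _).2 (by decide)))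
        (Or.inr ((hf _ _).2 (by decide))) (Or.inl ((hf _ _).2 (by decide)))
        (inj.ne (by decide)) (inj.ne (by decide)) with (e | e) | (e | e) <;>
      exact absurd ((hf _ _).1 e) (by decide)
    · rcases hG.nested (f 0) (f 2) (f 1) (f 3) (Or.inl ((hf _ _).2 (by decide)))
        (Or.inr ((hf _ _).2 (by decide))) (Or.inl ((hf _ _).2 (by decide)))
        (inj.ne (by decide)) (inj.ne (by decide)) with (e | e) | (e | e) <;>
      exact absurd ((hf _ _).1 e) (by decide)
  · rintro ⟨h₈, h₁₂⟩
    by_contra hn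
    obtain ⟨a, b, c, d, hab, hcb, hcd, hac, hbd, nac, nbd⟩ :=
      exists_alternating_of_not_nestedNeighborhoods h t hn
    rw [not_or] at nac nbd
    have hda : ¬ G.Adj d a := fun e ↦ nbd.2 (t _ _ _ e hab hbd.symm)
    have eab : a ≠ b := by
      rintro rfl
      exact irr _ hab
    have ecb : c ≠ b := by
      rintro rfl
      exact irr _ hcb
    have ecd : c ≠ d := by
      rintro rfl
      exact irr _ hcd
    have ead : a ≠ d := by
      rintro rfl
      exact nac.2 hcd
    -- Only `a → d` is still open: present, it gives `D12` with sources `a, c` and sinks `b, d`;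
    -- absent, `D8`.
    by_cases had : G.Adj a d
    · refine h₁₂ (ofArcs_isIndContained_iff.2 ⟨![a, c, b, d], ?_, ?_⟩)
      · intro i j
        fin_cases i <;> fin_cases j <;> simp [eab, ecb, ecd, ead, hac, hbd, eab.symm, ecb.symm,
          ecd.symm, ead.symm, hac.symm, hbd.symm]
      · intro i j
        fin_cases i <;> fin_cases j <;>
          simp [hab, hcb, hcd, had, hda, nac, nbd, irr, h _ _ hab, h _ _ hcb, h _ _ hcd]
    · refine h₈ (ofArcs_isIndContained_iff.2 ⟨![a, b, c, d], ?_, ?_⟩)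
      · intro i j
        fin_cases i <;> fin_cases j <;> simp [eab, ecb, ecd, ead, hac, hbd, eab.symm, ecb.symm,
          ecd.symm, ead.symm, hac.symm, hbd.symm]
      · intro i j
        fin_cases i <;> fin_cases j <;>
          simp [hab, hcb, hcd, had, hda, nac, nbd, irr, h _ _ hab, h _ _ hcb, h _ _ hcd]

end Digraph

theorem mainTheorem4 {V : Type*} [Finite V] [Nonempty V] (G : Digraph V) (hG : G.Loopless) :
    List.TFAE
      [G.IsOrientedTriviallyPerfect,
       G.Free {Digraph.D1, Digraph.D5, Digraph.D8, Digraph.D12, Digraph.biK2},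
       G.Free {Digraph.D1, Digraph.D5, Digraph.biK2} ∧
         G.toSimpleGraphInclusive.IndFree
           {⟨4, SimpleGraph.cycleGraph 4⟩, ⟨4, SimpleGraph.pathGraph 4⟩},
       G.Free {Digraph.D1, Digraph.D5, Digraph.biK2} ∧
         G.toSimpleGraphInclusive.IsTriviallyPerfect,
       G.IsTransitive ∧ G.Free {Digraph.biK2, Digraph.D8, Digraph.D12}] := by
  have main : G.IsOrientedTriviallyPerfect ↔ G.IsNestedOrder :=
    ⟨fun h ↦ h.isNestedOrder, fun h ↦ h.isOrientedTriviallyPerfect⟩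
  rw [← SimpleGraph.nestedNeighborhoods_iff_indFree,
    ← SimpleGraph.nestedNeighborhoods_iff_isTriviallyPerfect, main, Digraph.isNestedOrder_iff]
  simp only [Digraph.Free, Set.mem_insert_iff, Set.mem_singleton_iff, forall_eq_or_imp, forall_eq,
    hG.not_isIndContained_biK2_iff]
  have h (h : G.IsAsymmetric) : G.IsTransitive ↔ _ := h.isTransitive_iff
  have h' : G.IsAsymmetric → G.IsTransitive → (_ ↔ _) := fun h t ↦ h.nestedNeighborhoods_iff t
  by_cases ha : G.IsAsymmetric
  swap
  -- Without asymmetry all five conditions fail, since every list contains `biK2`.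
  · simp [ha]
  by_cases ht : G.IsTransitive
  swap
  -- Without transitivity `D1` or `D5` occurs, so again all five fail.
  · have hD := mt (h ha).2 ht
    rw [not_and_or] at hD
    simp only [ha, ht, false_and, and_false, and_true]
    tfae_have 1 → 2 := False.elim
    tfae_have 2 → 3 := by tauto
    tfae_have 3 → 4 := id
    tfae_have 4 → 5 := by tauto
    tfae_have 5 → 1 := id
    tfae_finish
  · simp [ha, ht, ((h ha).1 ht).1, ((h ha).1 ht).2, h' ha ht]
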